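/- **Setting.** Let $d\ge 1$ and $\lambda=(\lambda^1,\dots,\lambda^d):[0,1]^d\to\mathbb R^d$. Assume: - (LC) there is $L\ge 0$ with $|\lambda^\gamma(\mathbf u)-\lambda^\gamma(\mathbf v)|\le L\sum_{\gamma'}|u^{\gamma'}-v^{\gamma'}|$ for all $\gamma$ and all $\mathbf u,\mathbf v\in[0,1]^d$; - (USH) there is $\kappa>0$ with $\inf_{[0,1]^d}\lambda^{\gamma}-\sup_{[0,1]^d}\lambda^{\gamma+1}\ge\kappa$ for all $1\le\gamma\le d-1$. **Sticky particles.** Let $D_n=\{x\in\mathbb R^n: x_1\le\dots\le x_n\}$. The sticky particle dynamics started at $x\in D_n$ with initial velocities $(\bar\lambda_1,\dots,\bar\lambda_n)$ is defined as follows. The initial cluster of particle $k$ is the largest set of consecutive indices $\{\underline k,\dots,\overline k\}\ni k$ with $x_{\underline k}=\dots=x_{\overline k}$ and such that, for all $\underline k\le j<\overline k$, the average of $\bar\lambda$ over $\{\underline k,\dots,j\}$ is at least its average over $\{j+1,\dots,\overline k\}$. Clusters travel at constant velocity, the average of $\bar\lambda$ over the cluster, and stick together when they collide. **Multitype sticky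 particles (MSPD).** There are $n$ particles of each type $\gamma\in\{1,\dots,d\}$, the $k$-th particle of type $\gamma$ (denoted $\gamma{:}k$) being at $x_k^\gamma$; a configuration is $\mathbf x=(x^\gamma_k)\in D_n^d$. For $\gamma'\neq\gamma$ let $\omega^{\gamma'}_{\gamma:k}(\mathbf x)$ be $\frac1n\#\{k':x^{\gamma'}_{k'}<x^\gamma_k\}$ if $\gamma'<\gamma$ and $\frac1n\#\{k':x^{\gamma'}_{k'}\le x^\gamma_k\}$ if $\gamma'>\gamma$, and let $$\tilde\lambda^\gamma_k(\mathbf x)=n\int_{(k-1)/n}^{k/n}\lambda^\gamma\bigl(\omega^1_{\gamma:k}(\mathbf x),\dots,\omega^{\gamma-1}_{\gamma:k}(\mathbf x),w,\omega^{\gamma+1}_{\gamma:k}(\mathbf x),\dots,\omega^d_{\gamma:k}(\mathbf x)\bigr)\,dw .$$ The MSPD $(\Phi(\mathbf x;t))_{t\ge0}$ started at $\mathbf x$ lets each type $\gamma$ follow its own sticky particle dynamics with initial velocities $(\tilde\lambda^\gamma_k(\mathbf x))_{1\le k\le n}$ until the first time $t^*>0$ at which two particles $\alpha{:}i$, $\beta{:}j$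 with $\alpha<\beta$ and $x^\alpha_i<x^\beta_j$ collide; at time $t^*$ it restarts in the same way from the configuration reached. Its empirical measure is $$\mu[\mathbf x]=\frac1n\sum_{k=1}^n\delta_{(\Phi^1_k(\mathbf x;t),\dots,\Phi^d_k(\mathbf x;t))_{t\ge0}},$$ a probability measure on $C([0,\infty),\mathbb R^d)$ with the topology of locally uniform convergence. **Solutions.** Let $m^1,\dots,m^d$ be probability measures on $\mathbb R$, and let $u_0^\gamma(x)=m^\gamma((-\infty,x])$. Let $\mathbf x(n)\in D_n^d$, $n\ge1$, be such that for each $\gamma$ the measures $\frac1n\sum_{k=1}^n\delta_{x_k^\gamma(n)}$ converge weakly to $m^\gamma$. Let $\bar\mu$ be the weak limit of a subsequence of $(\mu[\mathbf x(n)])_{n\ge1}$, and let $$u^\gamma(t,x)=\bar\mu\bigl(\{X:X^\gamma(t)\le x\}\bigr),\qquad (t,x)\in[0,\infty)\times\mathbb R .$$ **Proposition.** Let $\gamma\in\{1,\dots,d\}$ be a strong rarefaction coordinate: there is $c>0$ such that $$\lambda^\gamma(u^1,\dots,u^{\gamma-1},b,u^{\gamma+1},\dots,u^d)-\lambda^\gamma(u^1,\dots,u^{\gamma-1},a,u^{\gamma+1},\dots,u^d)\ge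 c(b-a)$$ for all $0\le a\le b\le1$ and all $(u^{\gamma'})_{\gamma'\ne\gamma}\in[0,1]^{d-1}$. Then, for every $\mathbf u=(u^1,\dots,u^d)$ obtained as above, $u^\gamma$ is continuous on $(0,\infty)\times\mathbb R$. If moreover $u^\gamma_0$ is continuous on $\mathbb R$, then $u^\gamma$ is continuous on $[0,\infty)\times\mathbb R$. -/

import Mathlib

open Set Filter Topology MeasureTheory ProbabilityTheory
open scoped NNReal ENNReal

noncomputable section

namespace StickyParticles

/-! ## Characteristic fields

The characteristic fields are `lam γ`, `γ : Fin d`.  Only their values on the cube `[0,1]^d`, i.e. on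
`Set.Icc 0 1`, are ever used. -/

/-- Lipschitz continuity of the characteristic fields on `[0,1]^d`. -/
def LipschitzFields {d : ℕ} (lam : Fin d → (Fin d → ℝ) → ℝ) : Prop :=
  ∃ L : ℝ, 0 ≤ L ∧ ∀ γ : Fin d, ∀ u ∈ Icc (0 : Fin d → ℝ) 1, ∀ v ∈ Icc (0 : Fin d → ℝ) 1,
    |lam γ u - lam γ v| ≤ L * ∑ γ' : Fin d, |u γ' - v γ'|

/-- Uniform strict hyperbolicity: `inf lam^α - sup lam^(α+1) ≥ κ > 0` over `[0,1]^d`, for two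
consecutive types `α`, `α + 1` (the infimum and the supremum are unfolded). -/
def UniformlyStrictlyHyperbolic {d : ℕ} (lam : Fin d → (Fin d → ℝ) → ℝ) : Prop :=
  ∃ κ : ℝ, 0 < κ ∧ ∀ α β : Fin d, (β : ℕ) = (α : ℕ) + 1 →
    ∀ u ∈ Icc (0 : Fin d → ℝ) 1, ∀ v ∈ Icc (0 : Fin d → ℝ) 1, κ ≤ lam α u - lam β v

/-- `γ` is a strong rarefaction coordinate: on `[0,1]^d`, `lam^γ` increases in its `γ`-th variable
with slope at least some `c > 0`. -/
def IsStrongRarefaction {d : ℕ} (lam : Fin d → (Fin d → ℝ) → ℝ) (γ : Fin d) : Prop :=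
  ∃ c : ℝ, 0 < c ∧ ∀ u ∈ Icc (0 : Fin d → ℝ) 1, ∀ a b : ℝ, 0 ≤ a → a ≤ b → b ≤ 1 →
    c * (b - a) ≤ lam γ (Function.update u γ b) - lam γ (Function.update u γ a)

/-! ## Dynamics restarted at events -/

/-- The trajectory started at `x` which follows the free evolution `F x` until the first event time
`τ = sInf (C x)` (when there is one), and restarts at that time from the state `F x τ`.  At most `m`
events are treated. -/
def restart {S : Type*} (F : S → ℝ → S) (C : S → Set ℝ) : ℕ → S → ℝ → S
  | 0, x, t => F x t
  | m + 1, x, t =>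
      open scoped Classical in
      if (C x).Nonempty ∧ sInf (C x) ≤ t then
        restart F C m (F x (sInf (C x))) (t - sInf (C x))
      else F x t

theorem restart_zero {S : Type*} {F : S → ℝ → S} {C : S → Set ℝ} (hF : ∀ x, F x 0 = x)
    (hC : ∀ x, C x ⊆ Ioi 0) (m : ℕ) (x : S) : restart F C m x 0 = x := by
  induction m generalizing x with
  | zero => exact hF x
  | succ m ih =>
    rw [restart]
    split_ifs with h
    · have h0 : sInf (C x) = 0 :=
        le_antisymm h.2 (le_csInf h.1 fun t ht => (hC x ht).le)
      rw [h0, sub_zero, ih, hF]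
    · exact hF x

theorem restart_continuous {S : Type*} [TopologicalSpace S] {F : S → ℝ → S} {C : S → Set ℝ}
    (hF : ∀ x, F x 0 = x) (hC : ∀ x, C x ⊆ Ioi 0) (hcont : ∀ x, Continuous (F x))
    (m : ℕ) (x : S) : Continuous (restart F C m x) := by
  classical
  induction m generalizing x with
  | zero => exact hcont x
  | succ m ih =>
    by_cases h : (C x).Nonempty
    · have key : restart F C (m + 1) x = fun t =>
          if sInf (C x) ≤ t then restart F C m (F x (sInf (C x))) (t - sInf (C x)) else F x t := by
        funext t
        simp only [restart, h, true_and]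
      rw [key]
      refine Continuous.if_le ((ih _).comp (by fun_prop)) (hcont x) continuous_const continuous_id ?_
      intro t ht
      have ht' : sInf (C x) = t := ht
      rw [← ht', sub_self, restart_zero hF hC]
    · have key : restart F C (m + 1) x = F x := by
        funext t
        simp only [restart, h, false_and, if_false]
      rw [key]
      exact hcont x

/-! ## Sticky particle dynamics of one type

Particles are labelled by `k : Fin n`; a configuration is a nondecreasing `x : Fin n → ℝ`, and
`v : Fin n → ℝ` is the vector of initial velocities. -/

/-- Average of `v` over a set of labels. -/
def avg {n : ℕ} (v : Fin n → ℝ) (s : Finset (Fin n)) : ℝ :=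
  (∑ k ∈ s, v k) / (s.card : ℝ)

/-- The labels `i, …, j` share the same position and satisfy the stability condition: cut at any
label `m`, the left part is on average at least as fast as the right part. -/
def IsStableBlock {n : ℕ} (v x : Fin n → ℝ) (i j : Fin n) : Prop :=
  i ≤ j ∧ (∀ m ∈ Finset.Icc i j, x m = x i) ∧
    ∀ m : Fin n, i ≤ m → m < j → avg v (Finset.Ioc m j) ≤ avg v (Finset.Icc i m)

/-- The initial cluster of the particle `k`: the largest stable block containing `k`, i.e. the union
of all of them. -/
def initialCluster {n : ℕ} (v x : Fin n → ℝ) (k : Fin n) : Finset (Fin n) :=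
  open scoped Classical in
  Finset.univ.filter fun l =>
    ∃ i j : Fin n, IsStableBlock v x i j ∧ k ∈ Finset.Icc i j ∧ l ∈ Finset.Icc i j

/-- Velocity of (the cluster of) the particle `k`: the average of the initial velocities of the
particles of the cluster. -/
def clusterVelocity {n : ℕ} (v x : Fin n → ℝ) (k : Fin n) : ℝ :=
  avg v (initialCluster v x k)

/-- Free motion: each cluster travels at constant velocity. -/
def freeMotion {n : ℕ} (v x : Fin n → ℝ) (t : ℝ) : Fin n → ℝ :=
  fun k => x k + t * clusterVelocity v x k

/-- Times at which, in the free motion, two particles at distinct positions meet. -/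
def meetingTimes {n : ℕ} (v x : Fin n → ℝ) : Set ℝ :=
  {t | 0 < t ∧ ∃ k l : Fin n, x k < x l ∧ freeMotion v x t k = freeMotion v x t l}

/-- The sticky particle dynamics started at `x` with initial velocity vector `v`: clusters travel at
constant velocity, and colliding clusters merge into a cluster whose velocity is the average of the
initial velocities `v k` of its particles.  Each collision decreases the number of clusters, so that
there are fewer than `n` collisions. -/
def spd {n : ℕ} (v x : Fin n → ℝ) (t : ℝ) : Fin n → ℝ :=
  restart (freeMotion v) (meetingTimes v) n x t

/-! ## Multitype sticky particle dynamics

There are `n` particles of each type `γ : Fin d`.  A configuration is `x : Fin d → Fin n → ℝ` with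
each `x γ` nondecreasing, `x γ k` being the position of the particle `γ:k`. -/

/-- The pairs of particles `(α:i, β:j)` with `α < β` and `x α i < x β j`. -/
def orderedPairs {d n : ℕ} (x : Fin d → Fin n → ℝ) :
    Finset ((Fin d × Fin n) × (Fin d × Fin n)) :=
  open scoped Classical in
  Finset.univ.filter fun p => p.1.1 < p.2.1 ∧ x p.1.1 p.1.2 < x p.2.1 p.2.2

/-- The normalised rank of the particle `γ:k` among the particles of type `γ'`.  For `γ' < γ` it counts
the `k'` with `(γ':k', γ:k)` in `orderedPairs x`, for `γ' > γ` the `k'` with `(γ:k, γ':k')` not in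
`orderedPairs x`.  The value for `γ' = γ` is not used. -/
def rank {d n : ℕ} (x : Fin d → Fin n → ℝ) (γ : Fin d) (k : Fin n) (γ' : Fin d) : ℝ :=
  open scoped Classical in
  if γ' < γ then
    ((Finset.univ.filter fun k' : Fin n => ((γ', k'), (γ, k)) ∈ orderedPairs x).card : ℝ) / n
  else if γ < γ' then
    ((Finset.univ.filter fun k' : Fin n => ((γ, k), (γ', k')) ∉ orderedPairs x).card : ℝ) / n
  else 0

/-- The initial velocity of the particle `γ:k` in the configuration `x`.  As `k` runs from `0` to
`n - 1`, the mean is over `w` between `k / n` and `(k + 1) / n`. -/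
def initialVelocity {d n : ℕ} (lam : Fin d → (Fin d → ℝ) → ℝ) (x : Fin d → Fin n → ℝ)
    (γ : Fin d) (k : Fin n) : ℝ :=
  n * ∫ w in ((k : ℕ) : ℝ) / n..(((k : ℕ) : ℝ) + 1) / n, lam γ (Function.update (rank x γ k) γ w)

/-- The typewise dynamics: each type follows its own sticky particle dynamics, with the initial
velocities determined by `x`. -/
def typewise {d n : ℕ} (lam : Fin d → (Fin d → ℝ) → ℝ) (x : Fin d → Fin n → ℝ) (t : ℝ) :
    Fin d → Fin n → ℝ :=
  fun γ => spd (initialVelocity lam x γ) (x γ) t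

/-- Times at which, in the typewise dynamics, the particles of a pair of `orderedPairs x` collide. -/
def collisionTimes {d n : ℕ} (lam : Fin d → (Fin d → ℝ) → ℝ) (x : Fin d → Fin n → ℝ) : Set ℝ :=
  {t | 0 < t ∧ ∃ p ∈ orderedPairs x,
    typewise lam x t p.1.1 p.1.2 = typewise lam x t p.2.1 p.2.2}

/-- The multitype sticky particle dynamics started at `x`: the typewise dynamics is followed until the
first collision between particles of different types, where all the initial velocities are updated.
Each such collision decreases the cardinality of `orderedPairs`, which therefore bounds their number. -/
def mspd {d n : ℕ} (lam : Fin d → (Fin d → ℝ) → ℝ) (x : Fin d → Fin n → ℝ) (t : ℝ) :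
    Fin d → Fin n → ℝ :=
  restart (typewise lam) (collisionTimes lam) (orderedPairs x).card x t

theorem spd_zero {n : ℕ} (v x : Fin n → ℝ) : spd v x 0 = x :=
  restart_zero (fun x => by funext k; simp [freeMotion]) (fun _ _ ht => ht.1) n x

theorem spd_continuous {n : ℕ} (v x : Fin n → ℝ) : Continuous (spd v x) :=
  restart_continuous (fun x => by funext k; simp [freeMotion]) (fun _ _ ht => ht.1)
    (fun x => by unfold freeMotion; fun_prop) n x

theorem mspd_continuous {d n : ℕ} (lam : Fin d → (Fin d → ℝ) → ℝ) (x : Fin d → Fin n → ℝ) :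
    Continuous (mspd lam x) :=
  restart_continuous (fun x => by funext γ; exact spd_zero _ _) (fun _ _ ht => ht.1)
    (fun x => continuous_pi fun γ => spd_continuous _ _) _ x

/-! ## Empirical measures and their limits -/

/-- Sample paths `[0,∞) → ℝ^d`, with the topology of locally uniform convergence. -/
abbrev PathSpace (d : ℕ) : Type := C(ℝ≥0, Fin d → ℝ)

instance pathMeasurableSpace (d : ℕ) : MeasurableSpace (PathSpace d) := borel _

instance pathBorelSpace (d : ℕ) : BorelSpace (PathSpace d) := ⟨rfl⟩

/-- The empirical measure `(1 / n) ∑ δ_(y k)`. -/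
def empirical {E : Type*} [MeasurableSpace E] {n : ℕ} [NeZero n] (y : Fin n → E) :
    ProbabilityMeasure E :=
  ⟨(n : ℝ≥0∞)⁻¹ • ∑ k : Fin n, Measure.dirac (y k), ⟨by
    simp [ENNReal.inv_mul_cancel, NeZero.ne n]⟩⟩

/-- The path in `ℝ^d` of the `k`-th particles of all types. -/
def mspdPath {d n : ℕ} (lam : Fin d → (Fin d → ℝ) → ℝ) (x : Fin d → Fin n → ℝ) (k : Fin n) :
    PathSpace d :=
  ⟨fun t γ => mspd lam x t γ k, continuous_pi fun γ =>
    (continuous_apply k).comp ((continuous_apply γ).comp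
      ((mspd_continuous lam x).comp NNReal.continuous_coe))⟩

/-- The marginal distribution of the `γ`-th coordinate at time `t`. -/
def marginal {d : ℕ} (P : ProbabilityMeasure (PathSpace d)) (γ : Fin d) (t : ℝ≥0) : Measure ℝ :=
  (P : Measure (PathSpace d)).map fun w => w t γ

/-- `u` is obtained as a limit of the multitype sticky particle dynamics for the initial measures `m`:
there are configurations `x N`, with `N + 1` particles of each type, whose empirical measures converge
weakly to `m γ` for each type `γ`, and along a subsequence the empirical measures of the dynamics
converge weakly on the path space to some `P` such that `u γ t` is the cumulative distribution function
of the marginal of `P`. -/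
def IsMSPDLimit {d : ℕ} (lam : Fin d → (Fin d → ℝ) → ℝ) (m : Fin d → ProbabilityMeasure ℝ)
    (u : Fin d → ℝ≥0 → ℝ → ℝ) : Prop :=
  ∃ x : (N : ℕ) → Fin d → Fin (N + 1) → ℝ,
    (∀ N γ, Monotone (x N γ)) ∧
    (∀ γ, Tendsto (fun N => empirical (x N γ)) atTop (𝓝 (m γ))) ∧
    ∃ ν : ℕ → ℕ, StrictMono ν ∧ ∃ P : ProbabilityMeasure (PathSpace d),
      Tendsto (fun l => empirical (mspdPath lam (x (ν l)))) atTop (𝓝 P) ∧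
      ∀ γ t y, u γ t y = cdf (marginal P γ t) y

end StickyParticles

end

namespace StickyParticles

/-! ### Restarted dynamics -/

/-! The heart of the matter is a spacing estimate uniform in the number `n` of particles: at time
`t`, two particles `k ≤ l` of a strong rarefaction type `γ` are at distance at least `exp (-(L d /
κ)) c t (l - k) / n` (`mspd_spacing`). At a fixed time `t > 0`, an interval of length `ε` then
carries mass at most of order `ε + 1/n`, so the limiting marginal has no atom. Since limiting paths
are continuous, the absence of an atom at `y` at time `t` makes the distribution function jointly
continuous at `(t, y)` by dominated convergence (`continuousAt_cdf_marginal`). At time `0` the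
marginal is `m γ`, and its atoms are excluded by hypothesis.

For the spacing, let `D` be the distance between `γ:k` and `γ:l`, and `N` the mass of the particles
of other types between them. Rarefaction pushes the two apart at speed `c (l - k) / n`, but the
ranks of `γ:k` and `γ:l` differ because of the particles in between, which may cost up to `L N`
(`initialVelocity_sub_ge`). This loss is temporary: by hyperbolicity every particle in between moves
towards its exit at relative speed at least `κ`, whichever end is taken as reference, and never
comes back. Each particle is given a weight, the fraction of the gap left to cross; the total `Q` is
at most `d` and decreases at rate at least `κ N / D` (`potential_typewise_le`). Hence in `D exp (-(L
/ κ) Q)` the growth of the exponential factor offsets the loss `L N` exactly, and this quantity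
grows at rate at least `exp (-(L d / κ)) c (l - k) / n` (`weightedDistance_typewise`, chained over
collisions in `weightedDistance_restart`). It is a lower bound for `D`.

The computation requires particles of type `γ` to move freely between collisions of different types.
They do: with nothing in between, the particle on the right is faster, and a particle in between
would have to be hit first (`lt_of_mem_meetingTimes`). -/

theorem restart_of_le_sInf {S : Type*} {F : S → ℝ → S} {C : S → Set ℝ} (hF : ∀ x, F x 0 = x)
    (hC : ∀ x, C x ⊆ Ioi 0) (m : ℕ) (x : S) {t : ℝ} (h : (C x).Nonempty → t ≤ sInf (C x)) :
    restart F C m x t = F x t := by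
  cases m with
  | zero => rfl
  | succ m =>
    rw [restart]
    split_ifs with h'
    · have ht : t = sInf (C x) := le_antisymm (h h'.1) h'.2
      rw [← ht, sub_self, restart_zero hF hC]
    · rfl

theorem restart_le {S : Type*} {F : S → ℝ → S} {C : S → Set ℝ} (hC : ∀ x, C x ⊆ Ioi 0)
    (g : S → ℝ) {V : ℝ} (hg : ∀ x t, 0 ≤ t → g (F x t) ≤ g x + V * t) (m : ℕ) (x : S) {t : ℝ}
    (ht : 0 ≤ t) : g (restart F C m x t) ≤ g x + V * t := by
  induction m generalizing x t with
  | zero => exact hg x t ht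
  | succ m ih =>
    rw [restart]
    split_ifs with h
    · have h0 : 0 ≤ sInf (C x) := le_csInf h.1 fun s hs => (hC x hs).le
      have h1 := ih (F x (sInf (C x))) (sub_nonneg.2 h.2)
      have h2 := hg x _ h0
      linarith
    · exact hg x t ht

/-- The set of positive zeros of finitely many continuous functions not vanishing at `0` contains its
infimum. -/
theorem sInf_mem_of_zeros {ι : Type*} [Finite ι] {f : ι → ℝ → ℝ} (hf : ∀ i, Continuous (f i))
    (h0 : ∀ i, f i 0 ≠ 0) {S : Set ℝ} (hS : S = {t | 0 < t ∧ ∃ i, f i t = 0})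
    (hne : S.Nonempty) : sInf S ∈ S := by
  -- As no function vanishes at `0`, the condition `0 < t` may be relaxed to `0 ≤ t`, which makes
  -- the set closed.
  have hS' : S = ⋃ i, ({t | 0 ≤ t} ∩ {t | f i t = 0}) := by
    ext t
    simp only [hS, mem_ofPred_eq, mem_iUnion, mem_inter_iff]
    constructor
    · rintro ⟨ht, i, hi⟩
      exact ⟨i, ht.le, hi⟩
    · rintro ⟨i, ht, hi⟩
      refine ⟨lt_of_le_of_ne ht ?_, i, hi⟩
      rintro rfl
      exact h0 i hi
  have hcl : IsClosed S := by
    rw [hS']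
    exact isClosed_iUnion_of_finite fun i =>
      isClosed_Ici.inter (isClosed_eq (hf i) continuous_const)
  exact hcl.csInf_mem hne ⟨0, fun t ht => by rw [hS] at ht; exact ht.1.le⟩

/-! ### Sticky particles of one type -/

section OneType

variable {n : ℕ} {v x : Fin n → ℝ}

theorem avg_le {V : ℝ} {s : Finset (Fin n)} (hs : s.Nonempty) (h : ∀ k ∈ s, v k ≤ V) :
    avg v s ≤ V := by
  rw [avg, div_le_iff₀ (by exact_mod_cast hs.card_pos), mul_comm, ← nsmul_eq_mul]
  exact Finset.sum_le_card_nsmul _ _ _ h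

theorem le_avg {V : ℝ} {s : Finset (Fin n)} (hs : s.Nonempty) (h : ∀ k ∈ s, V ≤ v k) :
    V ≤ avg v s := by
  rw [avg, le_div_iff₀ (by exact_mod_cast hs.card_pos), mul_comm, ← nsmul_eq_mul]
  exact Finset.card_nsmul_le_sum _ _ _ h

theorem isStableBlock_self (v x : Fin n → ℝ) (k : Fin n) : IsStableBlock v x k k :=
  ⟨le_rfl, by simp, fun _ h h' => absurd (h.trans_lt h') (lt_irrefl _)⟩

theorem initialCluster_nonempty (v x : Fin n → ℝ) (k : Fin n) : (initialCluster v x k).Nonempty :=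
  ⟨k, by
    simp only [initialCluster, Finset.mem_filter, Finset.mem_univ, true_and]
    exact ⟨k, k, isStableBlock_self v x k, by simp, by simp⟩⟩

theorem freeMotion_zero (v x : Fin n → ℝ) : freeMotion v x 0 = x := by
  funext k
  simp [freeMotion]

theorem meetingTimes_subset (v x : Fin n → ℝ) : meetingTimes v x ⊆ Ioi 0 := fun _ ht => ht.1

theorem spd_le {V : ℝ} (hV : ∀ k, v k ≤ V) (x : Fin n → ℝ) (k : Fin n) {t : ℝ} (ht : 0 ≤ t) :
    spd v x t k ≤ x k + V * t := by
  refine restart_le (meetingTimes_subset v) (fun x => x k) (fun x t ht => ?_) n x ht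
  have := mul_le_mul_of_nonneg_left
    (avg_le (initialCluster_nonempty v x k) fun i _ => hV i) ht
  simp only [freeMotion, clusterVelocity]
  linarith

theorem le_spd {V : ℝ} (hV : ∀ k, V ≤ v k) (x : Fin n → ℝ) (k : Fin n) {t : ℝ} (ht : 0 ≤ t) :
    x k + V * t ≤ spd v x t k := by
  have := restart_le (F := freeMotion v) (V := -V) (meetingTimes_subset v) (fun x => - x k) (fun x t ht => ?_) n x ht
  · simp only [spd]
    linarith
  · have := mul_le_mul_of_nonneg_left
      (le_avg (initialCluster_nonempty v x k) fun i _ => hV i) ht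
    simp only [freeMotion, clusterVelocity]
    linarith

theorem sInf_meetingTimes_mem (h : (meetingTimes v x).Nonempty) :
    sInf (meetingTimes v x) ∈ meetingTimes v x := by
  refine sInf_mem_of_zeros (ι := {p : Fin n × Fin n // x p.1 < x p.2})
    (f := fun p t => freeMotion v x t p.1.1 - freeMotion v x t p.1.2)
    (fun p => by unfold freeMotion; fun_prop) (fun p => ?_) ?_ h
  · simp only [freeMotion_zero]
    exact (sub_neg.2 p.2).ne
  · ext t
    simp [meetingTimes, sub_eq_zero]

/-- If particles at the same position have strictly increasing velocities, then all clusters are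
singletons. -/
theorem clusterVelocity_eq_self (h : ∀ i j, i < j → x i = x j → v i < v j) (k : Fin n) :
    clusterVelocity v x k = v k := by
  have hblock : ∀ i j, IsStableBlock v x i j → i = j := by
    rintro i j ⟨hij, hx, hav⟩
    by_contra hne
    have hlt : i < j := lt_of_le_of_ne hij hne
    have h1 := hav i le_rfl hlt
    have h2 : avg v (Finset.Icc i i) = v i := by simp [avg]
    have hne' : (Finset.Ioc i j).Nonempty := ⟨j, by simp [hlt]⟩
    have h3 : v i < avg v (Finset.Ioc i j) := by
      rw [avg, lt_div_iff₀ (by exact_mod_cast hne'.card_pos), mul_comm, ← nsmul_eq_mul,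
        ← Finset.sum_const]
      refine Finset.sum_lt_sum_of_nonempty hne' fun m hm => ?_
      have hm' := Finset.mem_Ioc.1 hm
      exact h i m hm'.1 (hx m (Finset.mem_Icc.2 ⟨hm'.1.le, hm'.2⟩)).symm
    linarith
  have : initialCluster v x k = {k} := by
    ext l
    simp only [initialCluster, Finset.mem_filter, Finset.mem_univ, true_and,
      Finset.mem_singleton]
    constructor
    · rintro ⟨i, j, hb, hk, hl⟩
      obtain rfl := hblock i j hb
      simp only [Finset.Icc_self, Finset.mem_singleton] at hk hl
      rw [hk, hl]
    · rintro rfl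
      exact ⟨l, l, isStableBlock_self v x l, by simp, by simp⟩
  simp [clusterVelocity, this, avg]

end OneType

/-! ### Quantitative assumptions on the characteristic fields -/

/-- Lipschitz continuity with constant `L`. -/
def LipschitzFieldsWith {d : ℕ} (lam : Fin d → (Fin d → ℝ) → ℝ) (L : ℝ) : Prop :=
  ∀ γ : Fin d, ∀ u ∈ Icc (0 : Fin d → ℝ) 1, ∀ v ∈ Icc (0 : Fin d → ℝ) 1,
    |lam γ u - lam γ v| ≤ L * ∑ γ' : Fin d, |u γ' - v γ'|

/-- Any two characteristic fields are separated by `κ`. -/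
def SeparatedWith {d : ℕ} (lam : Fin d → (Fin d → ℝ) → ℝ) (κ : ℝ) : Prop :=
  ∀ α β : Fin d, α < β → ∀ u ∈ Icc (0 : Fin d → ℝ) 1, ∀ v ∈ Icc (0 : Fin d → ℝ) 1,
    κ ≤ lam α u - lam β v

/-- Strong rarefaction with slope `c`. -/
def StrongRarefactionWith {d : ℕ} (lam : Fin d → (Fin d → ℝ) → ℝ) (γ : Fin d) (c : ℝ) : Prop :=
  ∀ u ∈ Icc (0 : Fin d → ℝ) 1, ∀ a b : ℝ, 0 ≤ a → a ≤ b → b ≤ 1 →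
    c * (b - a) ≤ lam γ (Function.update u γ b) - lam γ (Function.update u γ a)

/-- The gaps between consecutive types add up along a chain from `α` to `β`, and each is positive,
so the total is at least one of them. -/
theorem UniformlyStrictlyHyperbolic.exists_separatedWith {d : ℕ}
    {lam : Fin d → (Fin d → ℝ) → ℝ} (h : UniformlyStrictlyHyperbolic lam) :
    ∃ κ, 0 < κ ∧ SeparatedWith lam κ := by
  obtain ⟨κ, hκ, h⟩ := h
  refine ⟨κ, hκ, ?_⟩
  have key : ∀ r : ℕ, ∀ α β : Fin d, (β : ℕ) = α + r + 1 →
      ∀ u ∈ Icc (0 : Fin d → ℝ) 1, ∀ v ∈ Icc (0 : Fin d → ℝ) 1, κ ≤ lam α u - lam β v := by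
    intro r
    induction r with
    | zero => exact fun α β hαβ => h α β hαβ
    | succ r ih =>
      intro α β hαβ u hu v hv
      have h1 := h α ⟨α + 1, by omega⟩ rfl u hu u hu
      have h2 := ih ⟨α + 1, by omega⟩ β (by simp only; omega) u hu v hv
      linarith
  intro α β hαβ
  exact key ((β : ℕ) - α - 1) α β (by have : (α : ℕ) < β := hαβ; omega)

section Velocities

variable {d n : ℕ} {lam : Fin d → (Fin d → ℝ) → ℝ} {L κ c : ℝ} {γ : Fin d}

theorem LipschitzFieldsWith.continuousOn (hL0 : 0 ≤ L) (hL : LipschitzFieldsWith lam L)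
    (γ : Fin d) : ContinuousOn (lam γ) (Icc 0 1) := by
  refine (LipschitzOnWith.of_dist_le_mul (K := ⟨L * d, by positivity⟩)
    fun u hu v hv => ?_).continuousOn
  rw [Real.dist_eq]
  refine (hL γ u hu v hv).trans ?_
  change _ ≤ L * d * dist u v
  rw [mul_assoc]
  refine mul_le_mul_of_nonneg_left ?_ hL0
  calc ∑ γ', |u γ' - v γ'| ≤ ∑ _γ' : Fin d, dist u v :=
        Finset.sum_le_sum fun i _ => by rw [← Real.dist_eq]; exact dist_le_pi_dist u v i
    _ = d * dist u v := by simp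

theorem rank_mem (x : Fin d → Fin n → ℝ) (γ : Fin d) (k : Fin n) :
    rank x γ k ∈ Icc (0 : Fin d → ℝ) 1 := by
  have hcard : ∀ s : Finset (Fin n), ((s.card : ℝ) / n) ∈ Icc (0 : ℝ) 1 := fun s =>
    ⟨by positivity, div_le_one_of_le₀ (by
      exact_mod_cast (Finset.card_le_univ s).trans (by simp)) (by positivity)⟩
  constructor <;> intro γ' <;> simp only [rank, Pi.zero_apply, Pi.one_apply] <;> split_ifs
  · exact (hcard _).1
  · exact (hcard _).1
  · exact le_rfl
  · exact (hcard _).2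
  · exact (hcard _).2
  · exact zero_le_one

theorem update_mem {u : Fin d → ℝ} (hu : u ∈ Icc (0 : Fin d → ℝ) 1) {w : ℝ}
    (hw : w ∈ Icc (0 : ℝ) 1) : Function.update u γ w ∈ Icc (0 : Fin d → ℝ) 1 := by
  constructor <;> intro γ' <;> rcases eq_or_ne γ' γ with rfl | hne
  · simpa using hw.1
  · simpa [hne] using hu.1 γ'
  · simpa using hw.2
  · simpa [hne] using hu.2 γ'

theorem label_add_div_mem (k : Fin n) {s : ℝ} (hs : s ∈ Icc (0 : ℝ) 1) :
    (k : ℝ) / n + s / n ∈ Icc (0 : ℝ) 1 := by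
  have hs0 := hs.1
  refine ⟨by positivity, ?_⟩
  rw [← add_div]
  have hk : ((k : ℕ) : ℝ) + 1 ≤ n := by exact_mod_cast k.2
  exact div_le_one_of_le₀ (by linarith [hs.2]) (by positivity)

/-- Rescaling to a common interval allows the velocities of two particles with different labels to
be compared pointwise under the integral. -/
theorem initialVelocity_eq_integral (x : Fin d → Fin n → ℝ) (γ : Fin d) (k : Fin n) :
    initialVelocity lam x γ k =
      ∫ s in (0 : ℝ)..1, lam γ (Function.update (rank x γ k) γ ((k : ℝ) / n + s / n)) := by
  have hn : (n : ℝ) ≠ 0 := by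
    have := k.pos
    positivity
  rw [intervalIntegral.integral_comp_add_div
    (fun w => lam γ (Function.update (rank x γ k) γ w)) hn, initialVelocity, smul_eq_mul,
    zero_div, add_zero, add_div]

theorem initialVelocity_integrable (hL0 : 0 ≤ L) (hL : LipschitzFieldsWith lam L)
    (x : Fin d → Fin n → ℝ) (γ : Fin d) (k : Fin n) :
    IntervalIntegrable
      (fun s => lam γ (Function.update (rank x γ k) γ ((k : ℝ) / n + s / n))) volume 0 1 := by
  refine ContinuousOn.intervalIntegrable ?_
  rw [uIcc_of_le zero_le_one]
  refine (hL.continuousOn hL0 γ).comp ?_ fun s hs =>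
    update_mem (rank_mem x γ k) (label_add_div_mem k hs)
  exact (Continuous.update continuous_const γ (by fun_prop)).continuousOn

/-- Differences of initial velocities are bounded below by differences of the fields. -/
theorem le_initialVelocity_sub (hL0 : 0 ≤ L) (hL : LipschitzFieldsWith lam L)
    (x : Fin d → Fin n → ℝ) (α β : Fin d) (i j : Fin n) {b : ℝ}
    (h : ∀ s ∈ Icc (0 : ℝ) 1, b ≤ lam α (Function.update (rank x α i) α ((i : ℝ) / n + s / n)) -
      lam β (Function.update (rank x β j) β ((j : ℝ) / n + s / n))) :
    b ≤ initialVelocity lam x α i - initialVelocity lam x β j := by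
  rw [initialVelocity_eq_integral, initialVelocity_eq_integral,
    ← intervalIntegral.integral_sub (initialVelocity_integrable hL0 hL x α i)
      (initialVelocity_integrable hL0 hL x β j)]
  have := intervalIntegral.integral_mono_on (μ := volume) (f := fun _ => b) zero_le_one
    (by simp) ((initialVelocity_integrable hL0 hL x α i).sub
      (initialVelocity_integrable hL0 hL x β j)) h
  simpa using this

theorem initialVelocity_separated (hL0 : 0 ≤ L) (hL : LipschitzFieldsWith lam L)
    (hκ : SeparatedWith lam κ) (x : Fin d → Fin n → ℝ) {α β : Fin d} (hαβ : α < β)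
    (i j : Fin n) : κ ≤ initialVelocity lam x α i - initialVelocity lam x β j :=
  le_initialVelocity_sub hL0 hL x α β i j fun _ hs =>
    hκ α β hαβ _ (update_mem (rank_mem x α i) (label_add_div_mem i hs)) _
      (update_mem (rank_mem x β j) (label_add_div_mem j hs))

/-- The field is compared through an intermediate point having the ranks of `γ:k` and the `γ`-th
variable of `γ:l`: changing the `γ`-th variable gains by rarefaction, changing the ranks costs at
most the Lipschitz bound. -/
theorem initialVelocity_rarefaction (hL0 : 0 ≤ L) (hL : LipschitzFieldsWith lam L)
    (hc : StrongRarefactionWith lam γ c) (x : Fin d → Fin n → ℝ) {k l : Fin n} (hkl : k ≤ l) :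
    c * (((l : ℝ) - k) / n) - L * ∑ γ', |rank x γ l γ' - rank x γ k γ'| ≤
      initialVelocity lam x γ l - initialVelocity lam x γ k := by
  refine le_initialVelocity_sub hL0 hL x γ γ l k fun s hs => ?_
  have hl := label_add_div_mem l hs
  have hk := label_add_div_mem k hs
  have hkl' : (k : ℝ) / n ≤ (l : ℝ) / n := by
    gcongr
    exact_mod_cast hkl
  have h1 := hc (rank x γ k) (rank_mem x γ k) ((k : ℝ) / n + s / n) ((l : ℝ) / n + s / n)
    hk.1 (by linarith) hl.2
  have h2 := hL γ _ (update_mem (γ := γ) (rank_mem x γ l) hl) _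
    (update_mem (γ := γ) (rank_mem x γ k) hl)
  have h3 : ∑ γ', |Function.update (rank x γ l) γ ((l : ℝ) / n + s / n) γ' -
      Function.update (rank x γ k) γ ((l : ℝ) / n + s / n) γ'| ≤
      ∑ γ', |rank x γ l γ' - rank x γ k γ'| := by
    refine Finset.sum_le_sum fun γ' _ => ?_
    rcases eq_or_ne γ' γ with rfl | hne
    · simp
    · simp [hne]
  have h4 := mul_le_mul_of_nonneg_left h3 hL0
  have h5 := (abs_le.1 (h2.trans h4)).1
  have h6 : c * ((l : ℝ) / n + s / n - ((k : ℝ) / n + s / n)) = c * (((l : ℝ) - k) / n) := by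
    ring
  linarith

end Velocities

/-! ### The typewise dynamics -/

section Typewise

variable {d n : ℕ} {lam : Fin d → (Fin d → ℝ) → ℝ} {L κ c : ℝ} {γ : Fin d}

theorem mem_orderedPairs {x : Fin d → Fin n → ℝ} {p : (Fin d × Fin n) × (Fin d × Fin n)} :
    p ∈ orderedPairs x ↔ p.1.1 < p.2.1 ∧ x p.1.1 p.1.2 < x p.2.1 p.2.2 := by
  simp [orderedPairs]

theorem typewise_zero (lam : Fin d → (Fin d → ℝ) → ℝ) (x : Fin d → Fin n → ℝ) :
    typewise lam x 0 = x := by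
  funext γ
  exact spd_zero _ _

theorem typewise_continuous (lam : Fin d → (Fin d → ℝ) → ℝ) (x : Fin d → Fin n → ℝ) :
    Continuous (typewise lam x) :=
  continuous_pi fun _ => spd_continuous _ _

theorem typewise_apply_continuous (lam : Fin d → (Fin d → ℝ) → ℝ) (x : Fin d → Fin n → ℝ)
    (α : Fin d) (i : Fin n) : Continuous fun t => typewise lam x t α i :=
  (continuous_apply i).comp ((continuous_apply α).comp (typewise_continuous lam x))

theorem collisionTimes_subset (lam : Fin d → (Fin d → ℝ) → ℝ) (x : Fin d → Fin n → ℝ) :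
    collisionTimes lam x ⊆ Ioi 0 := fun _ ht => ht.1

theorem sInf_collisionTimes_mem {x : Fin d → Fin n → ℝ} (h : (collisionTimes lam x).Nonempty) :
    sInf (collisionTimes lam x) ∈ collisionTimes lam x := by
  refine sInf_mem_of_zeros (ι := {p // p ∈ orderedPairs x})
    (f := fun p t => typewise lam x t p.1.1.1 p.1.1.2 - typewise lam x t p.1.2.1 p.1.2.2)
    (fun p => (typewise_apply_continuous lam x _ _).sub (typewise_apply_continuous lam x _ _))
    (fun p => ?_) ?_ h
  · simp only [typewise_zero]
    exact (sub_neg.2 (mem_orderedPairs.1 p.2).2).ne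
  · ext t
    simp [collisionTimes, sub_eq_zero]

/-- In the typewise dynamics, a particle of smaller type catches up at speed at least `κ`. -/
theorem typewise_separated (hL0 : 0 ≤ L) (hL : LipschitzFieldsWith lam L)
    (hκ : SeparatedWith lam κ) (x : Fin d → Fin n → ℝ) {α β : Fin d} (hαβ : α < β)
    (i j : Fin n) {t : ℝ} (ht : 0 ≤ t) :
    x α i - x β j + κ * t ≤ typewise lam x t α i - typewise lam x t β j := by
  have : Nonempty (Fin n) := ⟨i⟩
  obtain ⟨j', hj'⟩ := Finite.exists_max (initialVelocity lam x β)
  have h1 := spd_le hj' (x β) j ht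
  have h2 := le_spd (v := initialVelocity lam x α) (V := initialVelocity lam x β j' + κ)
    (fun i' => by have := initialVelocity_separated hL0 hL hκ x hαβ i' j'; linarith) (x α) i ht
  simp only [typewise]
  nlinarith

theorem orderedPairs_typewise_subset (hL0 : 0 ≤ L) (hL : LipschitzFieldsWith lam L) (hκ0 : 0 ≤ κ)
    (hκ : SeparatedWith lam κ) (x : Fin d → Fin n → ℝ) {t : ℝ} (ht : 0 ≤ t) :
    orderedPairs (typewise lam x t) ⊆ orderedPairs x := by
  intro p hp
  rw [mem_orderedPairs] at hp ⊢
  have := typewise_separated hL0 hL hκ x hp.1 p.1.2 p.2.2 ht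
  have := mul_nonneg hκ0 ht
  exact ⟨hp.1, by linarith [hp.2]⟩

/-- No pair can become ordered again, and the colliding pair is lost. This is what makes induction
on the number of collisions possible. -/
theorem card_orderedPairs_lt (hL0 : 0 ≤ L) (hL : LipschitzFieldsWith lam L) (hκ0 : 0 ≤ κ)
    (hκ : SeparatedWith lam κ) (x : Fin d → Fin n → ℝ) {t : ℝ} (ht : t ∈ collisionTimes lam x) :
    (orderedPairs (typewise lam x t)).card < (orderedPairs x).card := by
  obtain ⟨ht0, p, hp, hpt⟩ := ht
  refine Finset.card_lt_card ⟨orderedPairs_typewise_subset hL0 hL hκ0 hκ x ht0.le, fun h => ?_⟩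
  exact (mem_orderedPairs.1 (h hp)).2.ne hpt

theorem collisionTimes_eq_empty {x : Fin d → Fin n → ℝ} (h : orderedPairs x = ∅) :
    collisionTimes lam x = ∅ := by
  ext t
  simp [collisionTimes, h]

/-! ### Particles between two particles of the same type -/

/-- For the particles `γ:k` and `γ:l` (with `γ:l` on the right) the distance which the particle `γ':j`
still has to travel, relative to `γ:k` or `γ:l`, before having crossed both. -/
noncomputable def gap (x : Fin d → Fin n → ℝ) (γ : Fin d) (k l : Fin n) (γ' : Fin d) (j : Fin n) : ℝ :=
  if γ' < γ then x γ l - x γ' j else if γ < γ' then x γ' j - x γ k else 0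

/-- The particles of type `γ'` located between `γ:k` and `γ:l`. -/
noncomputable def between (x : Fin d → Fin n → ℝ) (γ : Fin d) (k l : Fin n) (γ' : Fin d) : Finset (Fin n) :=
  open scoped Classical in
  Finset.univ.filter fun j => 0 < gap x γ k l γ' j ∧ gap x γ k l γ' j ≤ x γ l - x γ k

theorem mem_between {x : Fin d → Fin n → ℝ} {k l : Fin n} {γ' : Fin d} {j : Fin n} :
    j ∈ between x γ k l γ' ↔ 0 < gap x γ k l γ' j ∧ gap x γ k l γ' j ≤ x γ l - x γ k := by
  simp [between]

theorem gap_self (x : Fin d → Fin n → ℝ) (k l j : Fin n) : gap x γ k l γ j = 0 := by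
  simp [gap]

theorem gap_continuous (lam : Fin d → (Fin d → ℝ) → ℝ) (x : Fin d → Fin n → ℝ) (γ : Fin d)
    (k l : Fin n) (γ' : Fin d) (j : Fin n) :
    Continuous fun t => gap (typewise lam x t) γ k l γ' j := by
  unfold gap
  split_ifs
  · exact (typewise_apply_continuous lam x _ _).sub (typewise_apply_continuous lam x _ _)
  · exact (typewise_apply_continuous lam x _ _).sub (typewise_apply_continuous lam x _ _)
  · exact continuous_const

/-- Only particles located between `γ:k` and `γ:l` are counted by one rank and not by the other. The
strict and large inequalities in `between` match those in `rank`. -/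
theorem abs_rank_sub_rank_le (x : Fin d → Fin n → ℝ) {k l : Fin n} (hkl : x γ k ≤ x γ l)
    (γ' : Fin d) :
    |rank x γ l γ' - rank x γ k γ'| ≤ (between x γ k l γ').card / n := by
  classical
  have key : ∀ A B C : Finset (Fin n), A ⊆ B → B ⊆ A ∪ C →
      |(B.card : ℝ) / n - (A.card : ℝ) / n| ≤ (C.card : ℝ) / n := by
    intro A B C hAB hBC
    have h1 : (A.card : ℝ) ≤ B.card := by exact_mod_cast Finset.card_le_card hAB
    have h2 : (B.card : ℝ) ≤ A.card + C.card := by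
      exact_mod_cast (Finset.card_le_card hBC).trans (Finset.card_union_le _ _)
    rw [← sub_div, abs_of_nonneg (div_nonneg (by linarith) (by positivity))]
    gcongr
    linarith
  unfold rank
  split_ifs with h h'
  · convert key _ _ (between x γ k l γ') ?_ ?_
    · intro j
      simp only [Finset.mem_filter, Finset.mem_univ, true_and, mem_orderedPairs]
      exact fun hj => ⟨hj.1, hj.2.trans_le hkl⟩
    · intro j
      simp only [Finset.mem_filter, Finset.mem_univ, true_and, mem_orderedPairs, Finset.mem_union,
        mem_between, gap, h, if_true]
      intro hj
      by_cases hjk : x γ' j < x γ k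
      · exact Or.inl hjk
      · exact Or.inr ⟨sub_pos.2 hj, by linarith⟩
  · convert key _ _ (between x γ k l γ') ?_ ?_
    · intro j
      simp only [Finset.mem_filter, Finset.mem_univ, true_and, mem_orderedPairs, h', not_lt]
      exact fun hj => hj.trans hkl
    · intro j
      simp only [Finset.mem_filter, Finset.mem_univ, true_and, mem_orderedPairs, Finset.mem_union,
        mem_between, gap, h, h', if_true, if_false, not_lt]
      intro hj
      by_cases hjk : x γ' j ≤ x γ k
      · exact Or.inl hjk
      · exact Or.inr ⟨by linarith, by linarith⟩
  · simp only [sub_self, abs_zero]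
    positivity

/-- The two quantities are signed distances from `γ':j` to the end it leaves by and to the end it
enters by. Both shrink at speed at least `κ`, whatever the motion of the ends relative to each
other. -/
theorem gap_typewise_le (hL0 : 0 ≤ L) (hL : LipschitzFieldsWith lam L)
    (hκ : SeparatedWith lam κ) (x : Fin d → Fin n → ℝ) (k l : Fin n) {γ' : Fin d} (hne : γ' ≠ γ)
    (j : Fin n) {t : ℝ} (ht : 0 ≤ t) :
    gap (typewise lam x t) γ k l γ' j ≤ gap x γ k l γ' j - κ * t ∧
      gap (typewise lam x t) γ k l γ' j - (typewise lam x t γ l - typewise lam x t γ k) ≤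
        gap x γ k l γ' j - (x γ l - x γ k) - κ * t := by
  rcases lt_or_gt_of_ne hne with h | h
  · have h1 := typewise_separated hL0 hL hκ x h j k ht
    have h2 := typewise_separated hL0 hL hκ x h j l ht
    simp only [gap, h, if_true]
    constructor <;> linarith
  · have h1 := typewise_separated hL0 hL hκ x h k j ht
    have h2 := typewise_separated hL0 hL hκ x h l j ht
    simp only [gap, h, h.not_gt, if_true, if_false]
    constructor <;> linarith

/-- A particle of another type does not cross `γ:k` and `γ:l` before the first collision. -/
theorem gap_typewise_nonneg {x : Fin d → Fin n → ℝ} {k l : Fin n} {γ' : Fin d} {j : Fin n}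
    (h0 : 0 < gap x γ k l γ' j) {T : ℝ} (hT0 : 0 ≤ T) (hT : ∀ t ∈ collisionTimes lam x, T ≤ t) :
    0 ≤ gap (typewise lam x T) γ k l γ' j := by
  by_contra! hneg
  have hcont := (gap_continuous lam x γ k l γ' j).continuousOn (s := Icc 0 T)
  obtain ⟨t, ht, hzero⟩ := intermediate_value_Ioo' hT0 hcont
    (show (0 : ℝ) ∈ Ioo _ _ from ⟨hneg, by simpa only [typewise_zero] using h0⟩)
  refine (hT t ⟨ht.1, ?_⟩).not_gt ht.2
  have hzero' : gap (typewise lam x t) γ k l γ' j = 0 := hzero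
  unfold gap at hzero' h0
  split_ifs at hzero' h0 with h h'
  · exact ⟨((γ', j), (γ, l)), mem_orderedPairs.2 ⟨h, sub_pos.1 h0⟩, (sub_eq_zero.1 hzero').symm⟩
  · exact ⟨((γ, k), (γ', j)), mem_orderedPairs.2 ⟨h', sub_pos.1 h0⟩, (sub_eq_zero.1 hzero').symm⟩
  · exact absurd h0 (lt_irrefl _)

/-! ### Free motion of a strong rarefaction type before the first collision. -/

theorem initialVelocity_sub_ge (hL0 : 0 ≤ L) (hL : LipschitzFieldsWith lam L)
    (hc : StrongRarefactionWith lam γ c) {x : Fin d → Fin n → ℝ} (hx : Monotone (x γ))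
    {k l : Fin n} (hkl : k ≤ l) :
    c * (((l : ℝ) - k) / n) - L * ∑ γ', ((between x γ k l γ').card : ℝ) / n ≤
      initialVelocity lam x γ l - initialVelocity lam x γ k := by
  have h1 := initialVelocity_rarefaction hL0 hL hc x hkl
  have h2 := mul_le_mul_of_nonneg_left
    (Finset.sum_le_sum fun γ' (_ : γ' ∈ Finset.univ) => abs_rank_sub_rank_le x (hx hkl) γ') hL0
  linarith

theorem label_sub_div_pos {k l : Fin n} (hkl : k < l) : 0 < ((l : ℝ) - k) / n := by
  have h : ((k : ℕ) : ℝ) < (l : ℕ) := by exact_mod_cast hkl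
  have := k.pos
  exact div_pos (sub_pos.2 h) (by positivity)

/-- If no particle is between `γ:k` and `γ:l`, then the latter is faster. -/
theorem initialVelocity_lt (hL0 : 0 ≤ L) (hL : LipschitzFieldsWith lam L) (hc0 : 0 < c)
    (hc : StrongRarefactionWith lam γ c) {x : Fin d → Fin n → ℝ} (hx : Monotone (x γ))
    {k l : Fin n} (hkl : k < l) (hB : ∀ γ', between x γ k l γ' = ∅) :
    initialVelocity lam x γ k < initialVelocity lam x γ l := by
  have h1 := initialVelocity_sub_ge hL0 hL hc hx hkl.le
  simp only [hB, Finset.card_empty, Nat.cast_zero, zero_div, Finset.sum_const_zero, mul_zero,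
    sub_zero] at h1
  linarith [mul_pos hc0 (label_sub_div_pos hkl)]

theorem between_eq_empty {x : Fin d → Fin n → ℝ} {k l : Fin n} (h : x γ k = x γ l)
    (γ' : Fin d) : between x γ k l γ' = ∅ := by
  ext j
  simp only [mem_between, h, sub_self, Finset.notMem_empty, iff_false, not_and, not_le,
    imp_self]

/-- Nothing lies between two particles at the same position, so their velocities increase strictly
with the label and every initial cluster is a single particle. -/
theorem freeMotion_rarefaction (hL0 : 0 ≤ L) (hL : LipschitzFieldsWith lam L) (hc0 : 0 < c)
    (hc : StrongRarefactionWith lam γ c) {x : Fin d → Fin n → ℝ} (hx : Monotone (x γ)) (t : ℝ)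
    (k : Fin n) : freeMotion (initialVelocity lam x γ) (x γ) t k =
      x γ k + t * initialVelocity lam x γ k := by
  rw [freeMotion, clusterVelocity_eq_self]
  exact fun i j hij h => initialVelocity_lt hL0 hL hc0 hc hx hij (between_eq_empty h)

/-- Particles of a strong rarefaction type do not meet before the first collision between
particles of different types. -/
theorem lt_of_mem_meetingTimes (hL0 : 0 ≤ L) (hL : LipschitzFieldsWith lam L) (hκ0 : 0 < κ)
    (hκ : SeparatedWith lam κ) (hc0 : 0 < c)
    (hc : StrongRarefactionWith lam γ c) {x : Fin d → Fin n → ℝ} (hx : Monotone (x γ)) {T : ℝ}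
    (hT : ∀ t ∈ collisionTimes lam x, T ≤ t) :
    ∀ s ∈ meetingTimes (initialVelocity lam x γ) (x γ), T < s := by
  intro s hs
  have hmem := sInf_meetingTimes_mem ⟨s, hs⟩
  have hle : sInf (meetingTimes (initialVelocity lam x γ) (x γ)) ≤ s :=
    csInf_le ⟨0, fun _ ht => ht.1.le⟩ hs
  refine lt_of_lt_of_le ?_ hle
  by_contra! hsT
  set s₀ := sInf (meetingTimes (initialVelocity lam x γ) (x γ)) with hs₀
  -- Up to and including the first meeting time `s₀`, the sticky dynamics is the free motion.
  have hfree : typewise lam x s₀ γ = freeMotion (initialVelocity lam x γ) (x γ) s₀ :=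
    restart_of_le_sInf (freeMotion_zero _) (meetingTimes_subset _) _ _ fun _ => le_rfl
  obtain ⟨h0, k, l, hxkl, heq⟩ := hmem
  have hkl : k < l := by
    by_contra! h
    exact (hx h).not_gt hxkl
  have heq' : typewise lam x s₀ γ k = typewise lam x s₀ γ l := by rw [hfree, heq]
  by_cases hB : ∀ γ', between x γ k l γ' = ∅
  · have h1 := mul_lt_mul_of_pos_left (initialVelocity_lt hL0 hL hc0 hc hx hkl hB) h0
    rw [freeMotion_rarefaction hL0 hL hc0 hc hx, freeMotion_rarefaction hL0 hL hc0 hc hx] at heq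
    linarith
  · push Not at hB
    obtain ⟨γ', j, hj⟩ := hB
    rw [mem_between] at hj
    have hne : γ' ≠ γ := by
      rintro rfl
      rw [gap_self] at hj
      exact lt_irrefl _ hj.1
    -- The particle `γ':j` is squeezed: it has not left through its exit end by time `s₀`, yet it
    -- has moved away from the other end by at least `κ s₀`. The distance between the two ends thus
    -- cannot vanish.
    have h1 := gap_typewise_nonneg hj.1 h0.le fun t ht => hsT.trans (hT t ht)
    have h2 := (gap_typewise_le hL0 hL hκ x k l hne j h0.le).2
    have h3 := mul_pos hκ0 h0
    linarith [hj.2]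

theorem typewise_rarefaction (hL0 : 0 ≤ L) (hL : LipschitzFieldsWith lam L) (hκ0 : 0 < κ)
    (hκ : SeparatedWith lam κ) (hc0 : 0 < c)
    (hc : StrongRarefactionWith lam γ c) {x : Fin d → Fin n → ℝ} (hx : Monotone (x γ)) {T : ℝ}
    (hT : ∀ t ∈ collisionTimes lam x, T ≤ t) (k : Fin n) :
    typewise lam x T γ k = x γ k + T * initialVelocity lam x γ k := by
  rw [← freeMotion_rarefaction hL0 hL hc0 hc hx]
  refine congrFun (restart_of_le_sInf (freeMotion_zero _) (meetingTimes_subset _) _ _ fun h => ?_) k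
  exact le_csInf h fun s hs =>
    (lt_of_mem_meetingTimes hL0 hL hκ0 hκ hc0 hc hx hT s hs).le

theorem typewise_strictMono (hL0 : 0 ≤ L) (hL : LipschitzFieldsWith lam L) (hκ0 : 0 < κ)
    (hκ : SeparatedWith lam κ) (hc0 : 0 < c)
    (hc : StrongRarefactionWith lam γ c) {x : Fin d → Fin n → ℝ} (hx : Monotone (x γ)) {T : ℝ}
    (hT0 : 0 < T) (hT : ∀ t ∈ collisionTimes lam x, T ≤ t) :
    StrictMono (typewise lam x T γ) := by
  intro k l hkl
  rw [typewise_rarefaction hL0 hL hκ0 hκ hc0 hc hx hT,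
    typewise_rarefaction hL0 hL hκ0 hκ hc0 hc hx hT]
  rcases (hx hkl.le).eq_or_lt with heq | hlt
  · have := mul_lt_mul_of_pos_left
      (initialVelocity_lt hL0 hL hc0 hc hx hkl (between_eq_empty heq)) hT0
    linarith
  -- If the order were lost, the two straight lines would have crossed at a time in `(0, T]`, which
  -- would be a meeting time.
  · by_contra! hle
    have hcont : ContinuousOn (fun t => (x γ l + t * initialVelocity lam x γ l) -
        (x γ k + t * initialVelocity lam x γ k)) (Icc 0 T) := by fun_prop
    obtain ⟨t, ht, hzero⟩ := intermediate_value_Ioc' hT0.le hcont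
      (show (0 : ℝ) ∈ Ico _ _ from ⟨by linarith, by simpa using hlt⟩)
    refine (lt_of_mem_meetingTimes hL0 hL hκ0 hκ hc0 hc hx hT t ⟨ht.1, k, l, hlt, ?_⟩).not_ge ht.2
    rw [freeMotion_rarefaction hL0 hL hc0 hc hx, freeMotion_rarefaction hL0 hL hc0 hc hx]
    exact (sub_eq_zero.1 hzero).symm

end Typewise

/-! ### The spacing functional -/

/-- The proportion of an interval of length `D` still to be crossed by a particle at distance `a` from
its end. -/
noncomputable def crossing (a D : ℝ) : ℝ :=
  if a ≤ 0 then 0 else if D ≤ a then 1 else a / D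

theorem crossing_nonneg {a D : ℝ} : 0 ≤ crossing a D := by
  unfold crossing
  split_ifs with h h'
  · exact le_rfl
  · exact zero_le_one
  · push Not at h h'
    exact (div_pos h (h.trans h')).le

theorem crossing_le_one {a D : ℝ} : crossing a D ≤ 1 := by
  unfold crossing
  split_ifs with h h'
  · exact zero_le_one
  · exact le_rfl
  · push Not at h h'
    exact div_le_one_of_le₀ h'.le (h.trans h').le

theorem crossing_of_nonpos {a D : ℝ} (h : a ≤ 0) : crossing a D = 0 := if_pos h

theorem crossing_of_lt {a D : ℝ} (h : 0 < a) (h' : D < a) : crossing a D = 1 := by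
  simp [crossing, h.not_ge, h'.le]

theorem crossing_of_between {a D : ℝ} (h : 0 < a) (h' : a ≤ D) : crossing a D = a / D := by
  unfold crossing
  rw [if_neg h.not_ge]
  split_ifs with h''
  · rw [le_antisymm h' h'', div_self (h.trans_le h').ne']
  · rfl

theorem crossing_le_div {a D : ℝ} (ha : 0 ≤ a) (hD : 0 < D) : crossing a D ≤ a / D := by
  unfold crossing
  split_ifs with h h'
  · positivity
  · rwa [one_le_div hD]
  · exact le_rfl

/-- With `θ = a₀ / D₀`, which lies in `(0, 1]`, the combination of `h1` and `h2` with weights `1 -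
θ` and `θ` gives `a + r ≤ θ D`. It does not matter whether the interval has expanded or contracted.
-/
theorem crossing_step {a₀ D₀ a D r : ℝ} (hD : 0 < D) (h1 : a ≤ a₀ - r)
    (h2 : a - D ≤ a₀ - D₀ - r) (h3 : 0 < a₀) (h4 : a₀ ≤ D₀) (h5 : 0 ≤ a) :
    crossing a D ≤ crossing a₀ D₀ - r / D := by
  have hD₀ : 0 < D₀ := h3.trans_le h4
  rw [crossing_of_between h3 h4]
  refine (crossing_le_div h5 hD).trans ?_
  rw [le_sub_iff_add_le, ← add_div, div_le_div_iff₀ hD hD₀]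
  nlinarith

section Spacing

variable {d n : ℕ} {lam : Fin d → (Fin d → ℝ) → ℝ} {L κ c : ℝ} {γ : Fin d}

/-- The mass of the particles of other types which have not yet crossed both `γ:k` and `γ:l`. -/
noncomputable def potential (x : Fin d → Fin n → ℝ) (γ : Fin d) (k l : Fin n) : ℝ :=
  ∑ γ', (∑ j, crossing (gap x γ k l γ' j) (x γ l - x γ k)) / n

theorem potential_nonneg (x : Fin d → Fin n → ℝ) (γ : Fin d) (k l : Fin n) :
    0 ≤ potential x γ k l :=
  Finset.sum_nonneg fun _ _ =>
    div_nonneg (Finset.sum_nonneg fun _ _ => crossing_nonneg) (by positivity)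

theorem potential_le (x : Fin d → Fin n → ℝ) (γ : Fin d) (k l : Fin n) :
    potential x γ k l ≤ d := by
  have hn : (0 : ℝ) < n := by exact_mod_cast k.pos
  have h : ∀ γ', (∑ j, crossing (gap x γ k l γ' j) (x γ l - x γ k)) / n ≤ 1 := by
    intro γ'
    rw [div_le_one hn]
    calc _ ≤ ∑ _j : Fin n, (1 : ℝ) := Finset.sum_le_sum fun _ _ => crossing_le_one
      _ = n := by simp
  calc _ ≤ ∑ _γ' : Fin d, (1 : ℝ) := Finset.sum_le_sum fun γ' _ => h γ'
    _ = d := by simp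

/-- The distance between `γ:k` and `γ:l`, weighted by the interactions to come. -/
noncomputable def weightedDistance (A : ℝ) (x : Fin d → Fin n → ℝ) (γ : Fin d) (k l : Fin n) : ℝ :=
  (x γ l - x γ k) * Real.exp (-(A * potential x γ k l))

theorem weightedDistance_le {A : ℝ} (hA : 0 ≤ A) {x : Fin d → Fin n → ℝ} {k l : Fin n}
    (h : 0 ≤ weightedDistance A x γ k l) : weightedDistance A x γ k l ≤ x γ l - x γ k := by
  have hD : 0 ≤ x γ l - x γ k := nonneg_of_mul_nonneg_left h (Real.exp_pos _)
  refine mul_le_of_le_one_right hD (Real.exp_le_one_iff.2 ?_)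
  have := mul_nonneg hA (potential_nonneg x γ k l)
  linarith

/-- Each particle initially between `γ:k` and `γ:l` loses at least `κ T / D`, where `D` is the final
distance. The others lose nothing but cannot gain: those already across stay across, and those not
yet inside start from the maximal value `1`. -/
theorem potential_typewise_le (hL0 : 0 ≤ L) (hL : LipschitzFieldsWith lam L) (hκ0 : 0 < κ)
    (hκ : SeparatedWith lam κ) {x : Fin d → Fin n → ℝ} {T : ℝ}
    (hT0 : 0 ≤ T) (hT : ∀ t ∈ collisionTimes lam x, T ≤ t) {k l : Fin n}
    (hD : 0 < typewise lam x T γ l - typewise lam x T γ k) :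
    potential (typewise lam x T) γ k l ≤ potential x γ k l -
      κ * T / (typewise lam x T γ l - typewise lam x T γ k) *
        ∑ γ', ((between x γ k l γ').card : ℝ) / n := by
  classical
  set r := κ * T with hr
  set D := typewise lam x T γ l - typewise lam x T γ k with hDdef
  have hr0 : 0 ≤ r := mul_nonneg hκ0.le hT0
  have hstep : ∀ γ' j, crossing (gap (typewise lam x T) γ k l γ' j) D ≤
      crossing (gap x γ k l γ' j) (x γ l - x γ k) -
        if j ∈ between x γ k l γ' then r / D else 0 := by
    intro γ' j
    rcases eq_or_ne γ' γ with rfl | hne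
    · rw [if_neg (by simp [mem_between, gap_self]), gap_self, gap_self,
        crossing_of_nonpos le_rfl, crossing_of_nonpos le_rfl, sub_zero]
    · have hg := gap_typewise_le hL0 hL hκ x k l hne j hT0
      split_ifs with hj
      · have hj' := mem_between.1 hj
        exact crossing_step hD hg.1 hg.2 hj'.1 hj'.2 (gap_typewise_nonneg hj'.1 hT0 hT)
      · rw [sub_zero]
        rcases le_or_gt (gap x γ k l γ' j) 0 with h0 | h0
        · rw [crossing_of_nonpos (by linarith [hg.1] : gap (typewise lam x T) γ k l γ' j ≤ 0)]
          exact crossing_nonneg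
        · have h1 : x γ l - x γ k < gap x γ k l γ' j := by
            by_contra! h
            exact hj (mem_between.2 ⟨h0, h⟩)
          rw [crossing_of_lt h0 h1]
          exact crossing_le_one
  unfold potential
  rw [Finset.mul_sum, ← Finset.sum_sub_distrib]
  refine Finset.sum_le_sum fun γ' _ => ?_
  rw [mul_div_assoc', ← sub_div]
  gcongr
  refine (Finset.sum_le_sum fun j _ => hstep γ' j).trans_eq ?_
  rw [Finset.sum_sub_distrib]
  congr 1
  rw [← Finset.sum_filter, Finset.sum_const, Finset.filter_mem_eq_inter, Finset.univ_inter,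
    nsmul_eq_mul, mul_comm]

/-- The guaranteed growth rate of the weighted distance. -/
noncomputable def spacingRate (d n : ℕ) (L κ c : ℝ) (k l : Fin n) : ℝ :=
  Real.exp (-(L / κ * d)) * (c * (((l : ℝ) - k) / n))

/-- With the weight `L / κ`, the decrease of the potential multiplies the exponential by at least
`exp (L N T / D) ≥ 1 + L N T / D`. Multiplied by the final distance `D`, this restores the `L N T`
lost to the particles in between. The argument needs no small `T`, because the same final `D`
appears in the decrease of the potential. -/
theorem weightedDistance_typewise (hL0 : 0 ≤ L) (hL : LipschitzFieldsWith lam L) (hκ0 : 0 < κ)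
    (hκ : SeparatedWith lam κ) (hc0 : 0 < c)
    (hc : StrongRarefactionWith lam γ c) {x : Fin d → Fin n → ℝ} (hx : Monotone (x γ)) {T : ℝ}
    (hT0 : 0 ≤ T) (hT : ∀ t ∈ collisionTimes lam x, T ≤ t) {k l : Fin n} (hkl : k < l) :
    weightedDistance (L / κ) x γ k l + spacingRate d n L κ c k l * T ≤
      weightedDistance (L / κ) (typewise lam x T) γ k l := by
  rcases hT0.eq_or_lt with rfl | hTpos
  · simp [typewise_zero]
  have hD : 0 < typewise lam x T γ l - typewise lam x T γ k :=
    sub_pos.2 (typewise_strictMono hL0 hL hκ0 hκ hc0 hc hx hTpos hT hkl)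
  have hQ := potential_typewise_le hL0 hL hκ0 hκ hT0 hT hD
  have hv := initialVelocity_sub_ge hL0 hL hc hx hkl.le
  have hDeq : typewise lam x T γ l - typewise lam x T γ k = (x γ l - x γ k) +
      (initialVelocity lam x γ l - initialVelocity lam x γ k) * T := by
    rw [typewise_rarefaction hL0 hL hκ0 hκ hc0 hc hx hT,
      typewise_rarefaction hL0 hL hκ0 hκ hc0 hc hx hT]
    ring
  unfold weightedDistance spacingRate
  set D := typewise lam x T γ l - typewise lam x T γ k
  set Q := potential (typewise lam x T) γ k l
  set Q₀ := potential x γ k l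
  set N := ∑ γ', ((between x γ k l γ').card : ℝ) / n
  set δ := ((l : ℝ) - k) / n
  have hδ : 0 < δ := label_sub_div_pos hkl
  have hA : 0 ≤ L / κ := div_nonneg hL0 hκ0.le
  have hexp : Real.exp (-(L / κ * Q₀)) * (1 + L * N * T / D) ≤ Real.exp (-(L / κ * Q)) := by
    calc _ ≤ Real.exp (-(L / κ * Q₀)) * Real.exp (L * N * T / D) := by
          gcongr
          rw [add_comm]
          exact Real.add_one_le_exp _
      _ = Real.exp (-(L / κ * Q₀) + L * N * T / D) := (Real.exp_add _ _).symm
      _ ≤ _ := by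
          refine Real.exp_le_exp.2 ?_
          have h1 := mul_le_mul_of_nonneg_left hQ hA
          have h2 : L / κ * (Q₀ - κ * T / D * N) = L / κ * Q₀ - L * N * T / D := by
            field_simp
          linarith
  -- Since the potential never exceeds `d`, the growth rate is uniform in `n` and in the
  -- configuration.
  have hrate : Real.exp (-(L / κ * d)) ≤ Real.exp (-(L / κ * Q₀)) :=
    Real.exp_le_exp.2 (neg_le_neg (mul_le_mul_of_nonneg_left (potential_le x γ k l) hA))
  have hDN : (x γ l - x γ k) + c * δ * T ≤ D * (1 + L * N * T / D) := by
    rw [mul_add, mul_one, mul_div_cancel₀ _ hD.ne', hDeq]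
    have := mul_le_mul_of_nonneg_right hv hTpos.le
    linarith
  calc _ ≤ (x γ l - x γ k) * Real.exp (-(L / κ * Q₀)) +
        Real.exp (-(L / κ * Q₀)) * (c * δ) * T := by gcongr
    _ = Real.exp (-(L / κ * Q₀)) * ((x γ l - x γ k) + c * δ * T) := by ring
    _ ≤ Real.exp (-(L / κ * Q₀)) * (D * (1 + L * N * T / D)) := by gcongr
    _ = D * (Real.exp (-(L / κ * Q₀)) * (1 + L * N * T / D)) := by ring
    _ ≤ D * Real.exp (-(L / κ * Q)) := by gcongr

theorem typewise_monotone (hL0 : 0 ≤ L) (hL : LipschitzFieldsWith lam L) (hκ0 : 0 < κ)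
    (hκ : SeparatedWith lam κ) (hc0 : 0 < c)
    (hc : StrongRarefactionWith lam γ c) {x : Fin d → Fin n → ℝ} (hx : Monotone (x γ)) {T : ℝ}
    (hT0 : 0 ≤ T) (hT : ∀ t ∈ collisionTimes lam x, T ≤ t) : Monotone (typewise lam x T γ) := by
  rcases hT0.eq_or_lt with rfl | hTpos
  · rwa [typewise_zero]
  · exact (typewise_strictMono hL0 hL hκ0 hκ hc0 hc hx hTpos hT).monotone

/-- The weighted distance depends only on the current configuration, so its increments add up over
successive collisions. Leaving `m` free above the number of ordered pairs lets the induction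
continue after a collision, where that number has dropped. -/
theorem weightedDistance_restart (hL0 : 0 ≤ L) (hL : LipschitzFieldsWith lam L) (hκ0 : 0 < κ)
    (hκ : SeparatedWith lam κ) (hc0 : 0 < c) (hc : StrongRarefactionWith lam γ c) {k l : Fin n}
    (hkl : k < l) (m : ℕ) {x : Fin d → Fin n → ℝ} (hm : (orderedPairs x).card ≤ m)
    (hx : Monotone (x γ)) {t : ℝ} (ht : 0 ≤ t) :
    weightedDistance (L / κ) x γ k l + spacingRate d n L κ c k l * t ≤
      weightedDistance (L / κ) (restart (typewise lam) (collisionTimes lam) m x t) γ k l := by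
  induction m generalizing x t with
  | zero =>
    refine weightedDistance_typewise hL0 hL hκ0 hκ hc0 hc hx ht ?_ hkl
    rw [collisionTimes_eq_empty (Finset.card_eq_zero.1 (Nat.le_zero.1 hm))]
    exact fun _ h => absurd h (notMem_empty _)
  | succ m ih =>
    have hle : ∀ s ∈ collisionTimes lam x, sInf (collisionTimes lam x) ≤ s := fun s hs =>
      csInf_le ⟨0, fun _ hs => hs.1.le⟩ hs
    rw [restart]
    split_ifs with h
    · have hmem := sInf_collisionTimes_mem h.1
      have h1 := weightedDistance_typewise hL0 hL hκ0 hκ hc0 hc hx hmem.1.le hle hkl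
      have h2 := card_orderedPairs_lt hL0 hL hκ0.le hκ x hmem
      have h3 := ih (by omega) (typewise_monotone hL0 hL hκ0 hκ hc0 hc hx hmem.1.le hle)
        (sub_nonneg.2 h.2)
      linarith
    · refine weightedDistance_typewise hL0 hL hκ0 hκ hc0 hc hx ht (fun s hs => ?_) hkl
      by_contra! hst
      exact h ⟨⟨s, hs⟩, (hle s hs).trans hst.le⟩

/-- Particles of a strong rarefaction type spread out. -/
theorem mspd_spacing (hL0 : 0 ≤ L) (hL : LipschitzFieldsWith lam L) (hκ0 : 0 < κ)
    (hκ : SeparatedWith lam κ) (hc0 : 0 < c) (hc : StrongRarefactionWith lam γ c)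
    {x : Fin d → Fin n → ℝ} (hx : Monotone (x γ)) {t : ℝ} (ht : 0 ≤ t) {k l : Fin n}
    (hkl : k ≤ l) :
    Real.exp (-(L / κ * d)) * (c * (((l : ℝ) - k) / n)) * t ≤
      mspd lam x t γ l - mspd lam x t γ k := by
  rcases hkl.eq_or_lt with rfl | hkl
  · simp
  have h1 := weightedDistance_restart hL0 hL hκ0 hκ hc0 hc hkl _ le_rfl hx ht
  have h2 : 0 ≤ weightedDistance (L / κ) x γ k l :=
    mul_nonneg (sub_nonneg.2 (hx hkl.le)) (Real.exp_pos _).le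
  have h3 : 0 ≤ spacingRate d n L κ c k l * t :=
    mul_nonneg (mul_nonneg (Real.exp_pos _).le
      (mul_nonneg hc0.le (label_sub_div_pos hkl).le)) ht
  have h4 := weightedDistance_le (div_nonneg hL0 hκ0.le) ((add_nonneg h2 h3).trans h1)
  change spacingRate d n L κ c k l * t ≤ _
  unfold mspd
  linarith

end Spacing

/-! ### Empirical measures -/

section Empirical

variable {E E' : Type*} [MeasurableSpace E] [MeasurableSpace E'] {n : ℕ} [NeZero n]

theorem empirical_apply (y : Fin n → E) {U : Set E} (hU : MeasurableSet U) [DecidablePred (· ∈ U)] :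
    (empirical y : Measure E) U = (n : ℝ≥0∞)⁻¹ * (Finset.univ.filter fun k => y k ∈ U).card := by
  change ((n : ℝ≥0∞)⁻¹ • ∑ k : Fin n, Measure.dirac (y k)) U = _
  rw [Measure.smul_apply, Measure.finsetSum_apply, smul_eq_mul, Finset.card_filter]
  congr 1
  push_cast
  refine Finset.sum_congr rfl fun k _ => ?_
  rw [Measure.dirac_apply' _ hU, indicator_apply]
  rfl

theorem empirical_map (y : Fin n → E) {f : E → E'} (hf : Measurable f) :
    (empirical y).map hf.aemeasurable = empirical fun k => f (y k) := by
  classical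
  apply Subtype.ext
  ext U hU
  change (Measure.map f (empirical y : Measure E)) U = (empirical fun k => f (y k) : Measure E') U
  rw [Measure.map_apply hf hU, empirical_apply _ (hf hU), empirical_apply _ hU]
  simp

/-- Points which are spread out charge small intervals little. -/
theorem empirical_Ioo_le {z : Fin n → ℝ} {R : ℝ} (hR : 0 < R)
    (hz : ∀ k l : Fin n, k ≤ l → R * (((l : ℝ) - k) / n) ≤ z l - z k) (a b : ℝ) (hab : a ≤ b) :
    (empirical z : Measure ℝ) (Ioo a b) ≤ ENNReal.ofReal ((b - a) / R + 1 / n) := by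
  classical
  have hn : (0 : ℝ) < n := by exact_mod_cast NeZero.pos n
  rw [empirical_apply _ measurableSet_Ioo]
  set s := Finset.univ.filter fun k => z k ∈ Ioo a b with hs
  have hcard : (s.card : ℝ) / n ≤ (b - a) / R + 1 / n := by
    rcases s.eq_empty_or_nonempty with h | h
    · rw [h]
      have := sub_nonneg.2 hab
      simp only [Finset.card_empty, Nat.cast_zero, zero_div]
      positivity
    · have hk := s.min'_mem h
      have hl := s.max'_mem h
      have hkl := s.min'_le _ hl
      set k := s.min' h with hkdef
      set l := s.max' h with hldef
      have h1 : s.card ≤ (l : ℕ) + 1 - k := by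
        rw [← Fin.card_Icc]
        exact Finset.card_le_card fun i hi =>
          Finset.mem_Icc.2 ⟨s.min'_le i hi, s.le_max' i hi⟩
      -- Labels from `k` to `l` inclusive are `l - k + 1` in number, which is the source of the term
      -- `1 / n`.
      have h2 : (s.card : ℝ) ≤ ((l : ℝ) - k) + 1 := by
        have : (k : ℕ) ≤ l := hkl
        have h3 : s.card + (k : ℕ) ≤ (l : ℕ) + 1 := by omega
        have h4 : (s.card : ℝ) + ((k : ℕ) : ℝ) ≤ ((l : ℕ) : ℝ) + 1 := by exact_mod_cast h3
        linarith
      have h5 : (((l : ℝ) - k) / n) ≤ (b - a) / R := by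
        rw [le_div_iff₀ hR, mul_comm]
        have hk' := (Finset.mem_filter.1 hk).2
        have hl' := (Finset.mem_filter.1 hl).2
        linarith [hz k l hkl, hk'.1, hl'.2]
      calc (s.card : ℝ) / n ≤ (((l : ℝ) - k) + 1) / n := by gcongr
        _ = ((l : ℝ) - k) / n + 1 / n := by rw [add_div]
        _ ≤ _ := by gcongr
  refine le_trans (le_of_eq ?_) (ENNReal.ofReal_le_ofReal hcard)
  rw [ENNReal.ofReal_div_of_pos hn, ENNReal.ofReal_natCast, ENNReal.ofReal_natCast, mul_comm,
    div_eq_mul_inv]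

/-- A weak limit of empirical measures of uniformly spread out points has no atoms. -/
theorem measure_singleton_eq_zero_of_tendsto_empirical {ν : ℕ → ℕ} (hν : StrictMono ν)
    {z : (l : ℕ) → Fin (ν l + 1) → ℝ} {R : ℝ} (hR : 0 < R)
    (hz : ∀ N, ∀ k l : Fin (ν N + 1), k ≤ l →
      R * (((l : ℝ) - k) / (ν N + 1 : ℕ)) ≤ z N l - z N k)
    {Q : ProbabilityMeasure ℝ} (hQ : Tendsto (fun N => empirical (z N)) atTop (𝓝 Q)) (y : ℝ) :
    (Q : Measure ℝ) {y} = 0 := by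
  have hbound : ∀ ε : ℝ, 0 < ε → (Q : Measure ℝ) {y} ≤ ENNReal.ofReal (2 * ε / R + ε) := by
    intro ε hε
    -- The portmanteau bound requires an open set, hence a small open interval around `y`.
    have h1 := ProbabilityMeasure.le_liminf_measure_open_of_tendsto hQ
      (isOpen_Ioo (a := y - ε) (b := y + ε))
    refine (measure_mono (t := Ioo (y - ε) (y + ε)) ?_).trans (h1.trans ?_)
    · rw [singleton_subset_iff]
      constructor <;> linarith
    refine liminf_le_of_frequently_le' (Eventually.frequently ?_)
    have h2 : Tendsto (fun N => 1 / ((ν N : ℝ) + 1)) atTop (𝓝 0) :=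
      tendsto_one_div_add_atTop_nhds_zero_nat.comp hν.tendsto_atTop
    filter_upwards [h2.eventually (gt_mem_nhds hε)] with N hN
    refine (empirical_Ioo_le hR (hz N) _ _ (by linarith)).trans (ENNReal.ofReal_le_ofReal ?_)
    push_cast
    rw [show y + ε - (y - ε) = 2 * ε by ring]
    gcongr
  have hlim : Tendsto (fun ε : ℝ => ENNReal.ofReal (2 * ε / R + ε)) (𝓝[>] 0) (𝓝 0) := by
    have : Tendsto (fun ε : ℝ => ENNReal.ofReal (2 * ε / R + ε)) (𝓝 0)
        (𝓝 (ENNReal.ofReal (2 * 0 / R + 0))) :=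
      (ENNReal.continuous_ofReal.comp (by fun_prop)).tendsto 0
    simp only [mul_zero, zero_div, add_zero, ENNReal.ofReal_zero] at this
    exact this.mono_left nhdsWithin_le_nhds
  refine le_antisymm (ge_of_tendsto hlim ?_) zero_le
  filter_upwards [self_mem_nhdsWithin] with ε hε
  exact hbound ε hε

end Empirical

/-! ### Marginals of measures on the path space -/

section Marginals

variable {d : ℕ}

theorem continuous_eval_path (γ : Fin d) (t : ℝ≥0) : Continuous fun w : PathSpace d => w t γ :=
  (continuous_apply γ).comp (continuous_eval_const t)

/-- The distribution function of the marginals is continuous at `(t, y)` when `y` is not an atom of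
the marginal at time `t`. -/
theorem continuousAt_cdf_marginal (P : ProbabilityMeasure (PathSpace d)) (γ : Fin d) (t : ℝ≥0)
    (y : ℝ) (h : marginal P γ t {y} = 0) :
    ContinuousAt (fun p : ℝ≥0 × ℝ => cdf (marginal P γ p.1) p.2) (t, y) := by
  have hmeas : ∀ s : ℝ≥0, Measurable fun w : PathSpace d => w s γ := fun s =>
    (continuous_eval_path γ s).measurable
  have hcdf : ∀ p : ℝ≥0 × ℝ, cdf (marginal P γ p.1) p.2 =
      ((P : Measure (PathSpace d)) {w | w p.1 γ ≤ p.2}).toReal := by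
    intro p
    have : IsProbabilityMeasure (marginal P γ p.1) :=
      Measure.isProbabilityMeasure_map (hmeas p.1).aemeasurable
    rw [cdf_eq_real, measureReal_def, marginal, Measure.map_apply (hmeas p.1) measurableSet_Iic]
    rfl
  have hset : ∀ p : ℝ≥0 × ℝ, MeasurableSet {w : PathSpace d | w p.1 γ ≤ p.2} := fun p =>
    hmeas p.1 measurableSet_Iic
  rw [funext hcdf]
  refine (ENNReal.tendsto_toReal
    (measure_ne_top (P : Measure (PathSpace d)) {w | w t γ ≤ y})).comp ?_
  refine tendsto_measure_of_ae_tendsto_indicator_of_isFiniteMeasure _ (hset (t, y)) hset ?_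
  rw [marginal, Measure.map_apply (hmeas t) (measurableSet_singleton y)] at h
  -- For almost every path `w t γ ≠ y`. By continuity of the path, its position then stays on the
  -- same side of the level for all nearby times and levels, so the indicator is locally constant.
  filter_upwards [measure_eq_zero_iff_ae_notMem.1 h] with w hw
  have hne : w t γ ≠ y := hw
  have hcont : Continuous fun p : ℝ≥0 × ℝ => w p.1 γ := by fun_prop
  rcases lt_or_gt_of_ne hne with hlt | hgt
  · filter_upwards [hcont.continuousAt.eventually_lt continuous_snd.continuousAt
      (show w (t, y).1 γ < (t, y).2 from hlt)] with p hp
    exact iff_of_true hp.le hlt.le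
  · filter_upwards [continuous_snd.continuousAt.eventually_lt hcont.continuousAt
      (show (t, y).2 < w (t, y).1 γ from hgt)] with p hp
    exact iff_of_false hp.not_ge hgt.not_ge

theorem tendsto_empirical_marginal {ι : Type*} {l : Filter ι} {n : ι → ℕ} [∀ i, NeZero (n i)]
    {w : (i : ι) → Fin (n i) → PathSpace d} {P : ProbabilityMeasure (PathSpace d)}
    (h : Tendsto (fun i => empirical (w i)) l (𝓝 P)) (γ : Fin d) (t : ℝ≥0) :
    Tendsto (fun i => empirical fun k => w i k t γ) l
      (𝓝 (P.map (continuous_eval_path γ t).measurable.aemeasurable)) := by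
  have := ProbabilityMeasure.tendsto_map_of_tendsto_of_continuous _ _ h (continuous_eval_path γ t)
  refine this.congr fun i => ?_
  exact empirical_map (w i) (continuous_eval_path γ t).measurable

/-- A probability measure on `ℝ` with continuous distribution function has no atoms. -/
theorem measure_singleton_eq_zero_of_continuous_cdf (μ : Measure ℝ) [IsProbabilityMeasure μ]
    (h : Continuous fun y => cdf μ y) (y : ℝ) : μ {y} = 0 := by
  rw [← measure_cdf μ, StieltjesFunction.measure_singleton,
    h.continuousAt.continuousWithinAt.leftLim_eq, sub_self, ENNReal.ofReal_zero]

end Marginals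

end StickyParticles

/-! ### Continuity of the limiting distribution functions. -/

theorem proposition5p3 {d : ℕ} (lam : Fin d → (Fin d → ℝ) → ℝ)
    (hLC : StickyParticles.LipschitzFields lam)
    (hUSH : StickyParticles.UniformlyStrictlyHyperbolic lam)
    (γ : Fin d) (hγ : StickyParticles.IsStrongRarefaction lam γ)
    (m : Fin d → ProbabilityMeasure ℝ) (u : Fin d → ℝ≥0 → ℝ → ℝ)
    (hu : StickyParticles.IsMSPDLimit lam m u) :
    ContinuousOn (fun p : ℝ≥0 × ℝ => u γ p.1 p.2) {p : ℝ≥0 × ℝ | 0 < p.1} ∧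
      (Continuous (fun y : ℝ => cdf (m γ : Measure ℝ) y) →
        Continuous (fun p : ℝ≥0 × ℝ => u γ p.1 p.2)) := by
  obtain ⟨L, hL0, hL : StickyParticles.LipschitzFieldsWith lam L⟩ := hLC
  obtain ⟨κ, hκ0, hκ⟩ := hUSH.exists_separatedWith
  obtain ⟨c, hc0, hc : StickyParticles.StrongRarefactionWith lam γ c⟩ := hγ
  obtain ⟨x, hmono, hinit, ν, hν, P, hP, hcdf⟩ := hu
  simp only [hcdf]
  have hpos : ∀ p : ℝ≥0 × ℝ, 0 < p.1 → ContinuousAt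
      (fun p : ℝ≥0 × ℝ => cdf (StickyParticles.marginal P γ p.1) p.2) p := by
    rintro ⟨t, y⟩ ht
    have ht' : (0 : ℝ) < t := by exact_mod_cast ht
    refine StickyParticles.continuousAt_cdf_marginal P γ t y ?_
    refine StickyParticles.measure_singleton_eq_zero_of_tendsto_empirical hν
      (R := Real.exp (-(L / κ * d)) * c * t) (by positivity) (fun N k l hkl => ?_)
      (StickyParticles.tendsto_empirical_marginal hP γ t) y
    refine le_trans (le_of_eq ?_) (StickyParticles.mspd_spacing hL0 hL hκ0 hκ hc0 hc
      (hmono (ν N) γ) ht'.le hkl)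
    ring
  refine ⟨fun p hp => (hpos p hp).continuousWithinAt, fun hm => ?_⟩
  rw [continuous_iff_continuousAt]
  rintro ⟨t, y⟩
  rcases eq_zero_or_pos t with rfl | ht
  -- The spacing bound degenerates at time `0`. There the marginal is identified with `m γ` instead,
  -- by uniqueness of weak limits, the dynamics starting from the given configurations.
  · refine StickyParticles.continuousAt_cdf_marginal P γ 0 y ?_
    have h1 := StickyParticles.tendsto_empirical_marginal hP γ 0
    have h2 : Tendsto (fun N => StickyParticles.empirical (x (ν N) γ)) atTop (𝓝 (m γ)) :=
      (hinit γ).comp hν.tendsto_atTop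
    have h3 : ∀ N, (fun k => StickyParticles.mspdPath lam (x (ν N)) k 0 γ) = x (ν N) γ := by
      intro N
      funext k
      exact congrFun (congrFun (StickyParticles.restart_zero
        (StickyParticles.typewise_zero lam) (StickyParticles.collisionTimes_subset lam)
        _ (x (ν N))) γ) k
    simp only [h3] at h1
    have h4 : StickyParticles.marginal P γ 0 = m γ :=
      congrArg (fun Q : ProbabilityMeasure ℝ => (Q : Measure ℝ)) (tendsto_nhds_unique h1 h2)
    rw [h4]
    exact StickyParticles.measure_singleton_eq_zero_of_continuous_cdf _ hm y
  · exact hpos (t, y) ht
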